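/- **Setting.** Fix a finite set of propositional atoms and a set of atomic actions. Boolean formulas $\varphi,\psi$ are built from atoms, $\top,\bot$ and the usual connectives; complex formulas may also use boxes $[a]$, one for each action $a$, and $\langle a\rangle\Phi:=\neg[a]\neg\Phi$. A model is a set $W$ of valuations together with a relation $R_a\subseteq W\times W$ for each action $a$; formulas are evaluated at worlds in the usual Kripke manner (an atom $p$ is true at $w$ iff $w$ makes $p$ true). $\Sigma\models\Phi$ means that every model in which all formulas of $\Sigma$ are true at all worlds is one in which $\Phi$ is true at all worlds; $\Sigma\models T$ means $\Sigma\models\Psi$ for all $\Psi\in T$; $\vdash$ is consequence in classical propositional logic. A *law* is a static law $\varphi$, an effect law $\varphi\to[a]\psi$, or an executability law $\varphi\to\langle a\rangle\top$, with $\varphi,\psi$ Boolean. An *action theory* is a set $T=S\cup E\cup X$ of static laws ($S$), effect laws ($E$) and executability laws ($X$); $E_a$, $X_a$ are the laws about $a$. $T$ is *modular* if $T\models\varphi$ implies $S\vdash\varphi$ for every Boolean $\varphi$. A *term* is a consistent finite set of literals, identified with its conjunction; a *prime implicant* of a set of Boolean formulas is a weakest term implying all of them. For Boolean $\varphi$,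 a *$\varphi$-context* is a formula $c=\pi\wedge\varphi_A$, where $\pi$ is a prime implicant of $S\wedge\varphi$, $A$ is a set of atoms not occurring in $\pi$, $\varphi_A$ is the conjunction of the atoms of $A$ and of the negations of all other atoms not occurring in $\pi$, and $S\not\vdash c\to\bot$. Let $\ominus$ be a classical contraction or erasure operator: it assigns to a set $S$ of Boolean formulas and a Boolean formula $\varphi$ a set $S\ominus\varphi$ of possible results, subject to the following basic Katsuno–Mendelzon postulates, common to contraction and erasure. For every $S^-\in S\ominus\varphi$: $S\vdash S^-$; if $S$ is consistent and $S\vdash\neg\varphi$ then $S^-\vdash S$; if $S$ is consistent and $\varphi$ is not a tautology then $S^-\not\vdash\varphi$; $S^-\cup\{\varphi\}\vdash S$; and equivalent inputs have, up to equivalence, the same results. **Contraction.** The set $T^-_\Phi$ of contractions of a law $\Phi$ from $T$ is defined as follows. 1. $\Phi=\varphi\to\langle a\rangle\top$. If $T\not\models\Phi$, then $T^-_\Phi=\{T\}$. Otherwise $T^-_\Phi$ consists of the theories $$(T\setminus X_a)\cup\{(\varphi_i\wedge\neg c)\to\langle a\rangle\top:\ (\varphi_i\to\langle a\rangle\top)\in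 X_a\},\qquad c\text{ a }\varphi\text{-context}.$$ 2. $\Phi=\varphi\to[a]\psi$. If $T\not\models\Phi$, then $T^-_\Phi=\{T\}$. Otherwise let $E_a^-$ be the union of all inclusion-minimal $F\subseteq E_a$ with $S\cup F\models\Phi$. Then $T^-_\Phi$ consists of the theories $$\begin{aligned}(T\setminus E_a^-)&\cup\{(\varphi_i\wedge\neg c)\to[a]\psi_i:\ (\varphi_i\to[a]\psi_i)\in E_a^-\}\\&\cup\{(\varphi_i\wedge c)\to[a](\psi_i\vee\pi'):\ (\varphi_i\to[a]\psi_i)\in E_a^-\}\\&\cup\{(c\wedge\ell)\to[a](\psi\vee\ell):\ \ell\in\Lambda\},\end{aligned}$$ where $c$ is a $\varphi$-context, $\pi'$ is a prime implicant of $S\wedge\neg\psi$, and $\Lambda$ is the set of literals $\ell$ that belong to some set $L$ of literals with $S\vdash c\to\bigwedge L$ and $S\not\vdash(\pi'\wedge\bigwedge L)\to\bot$, and for which $\ell\in\pi'$ or $T\not\models(c\wedge\ell)\to[a]\neg\ell$. 3. $\Phi=\varphi$ Boolean. If $S\not\vdash\varphi$, then $T^-_\Phi=\{T\}$. Otherwise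 $T^-_\Phi$ consists of the theories $$E\cup S^-\cup\{(\varphi_i\wedge\varphi)\to\langle a\rangle\top:\ a\text{ an action},\ (\varphi_i\to\langle a\rangle\top)\in X_a\}\cup\{\neg\varphi\to[a]\bot:\ a\text{ an action}\},\qquad S^-\in S\ominus\varphi.$$ **Theorem (recovery).** Let $T$ be a modular action theory and $\Phi$ a law. Then for every $T'\in T^-_\Phi$, $$T'\cup\{\Phi\}\models T.$$ -/

import Mathlib

namespace ActionLogic

section Grammar

/-- Boolean formulas over a set of propositional constants (fluents). -/
inductive BoolFormula (Atom : Type*) where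
  | atom (p : Atom)
  | top
  | bot
  | neg (φ : BoolFormula Atom)
  | and (φ ψ : BoolFormula Atom)
  | or (φ ψ : BoolFormula Atom)
  | imp (φ ψ : BoolFormula Atom)
  | iff (φ ψ : BoolFormula Atom)

/-- Complex formulas: the Boolean language enriched with one box per atomic action. -/
inductive Formula (Atom Act : Type*) where
  | atom (p : Atom)
  | top
  | bot
  | box (a : Act) (Φ : Formula Atom Act)
  | neg (Φ : Formula Atom Act)
  | and (Φ Ψ : Formula Atom Act)
  | or (Φ Ψ : Formula Atom Act)
  | imp (Φ Ψ : Formula Atom Act)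
  | iff (Φ Ψ : Formula Atom Act)

variable {Atom Act : Type*}

/-- The dual operator `⟨a⟩Φ := ¬[a]¬Φ`. -/
def Formula.dia (a : Act) (Φ : Formula Atom Act) : Formula Atom Act :=
  .neg (.box a (.neg Φ))

/-- Boolean formulas are complex formulas. -/
def BoolFormula.toFormula : BoolFormula Atom → Formula Atom Act
  | .atom p => .atom p
  | .top => .top
  | .bot => .bot
  | .neg φ => .neg φ.toFormula
  | .and φ ψ => .and φ.toFormula ψ.toFormula
  | .or φ ψ => .or φ.toFormula ψ.toFormula
  | .imp φ ψ => .imp φ.toFormula ψ.toFormula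
  | .iff φ ψ => .iff φ.toFormula ψ.toFormula

/-- The conjunction of a finite list of Boolean formulas (`⊤` for the empty list). -/
def BoolFormula.conj : List (BoolFormula Atom) → BoolFormula Atom
  | [] => .top
  | φ :: l => .and φ (BoolFormula.conj l)

/-- Literals: atoms and negated atoms. -/
inductive Literal (Atom : Type*) where
  | pos (p : Atom)
  | neg (p : Atom)

/-- The atom occurring in a literal. -/
def Literal.atom : Literal Atom → Atom
  | .pos p => p
  | .neg p => p

/-- The complementary literal; `¬¬p` is identified with `p`. -/
def Literal.compl : Literal Atom → Literal Atom
  | .pos p => .neg p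
  | .neg p => .pos p

/-- A literal as a Boolean formula. -/
def Literal.toBool : Literal Atom → BoolFormula Atom
  | .pos p => .atom p
  | .neg p => .neg (.atom p)

/-- The conjunction of the literals of a finite set. -/
noncomputable def litConj (L : Finset (Literal Atom)) : BoolFormula Atom :=
  BoolFormula.conj (L.toList.map Literal.toBool)

end Grammar

section Semantics

variable {Atom Act : Type*}

/-- A valuation (a maximal consistent set of literals), given by the set of its positive
literals, i.e. of the atoms that are true in it. -/
abbrev Valuation (Atom : Type*) := Set Atom

/-- `v ⊩ φ`: satisfaction of a Boolean formula by a valuation. -/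
def BoolFormula.Sat (v : Valuation Atom) : BoolFormula Atom → Prop
  | .atom p => p ∈ v
  | .top => True
  | .bot => False
  | .neg φ => ¬ φ.Sat v
  | .and φ ψ => φ.Sat v ∧ ψ.Sat v
  | .or φ ψ => φ.Sat v ∨ ψ.Sat v
  | .imp φ ψ => φ.Sat v → ψ.Sat v
  | .iff φ ψ => (φ.Sat v ↔ ψ.Sat v)

/-- Consequence in classical propositional logic. -/
def CPLEntails (S : Set (BoolFormula Atom)) (φ : BoolFormula Atom) : Prop :=
  ∀ v : Valuation Atom, (∀ σ ∈ S, σ.Sat v) → φ.Sat v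

/-- A model: a set of valuations (the possible worlds) with one accessibility relation
between possible worlds for each atomic action. -/
structure PDLModel (Atom Act : Type*) where
  worlds : Set (Valuation Atom)
  rel : Act → Valuation Atom → Valuation Atom → Prop
  rel_left : ∀ {a w w'}, rel a w w' → w ∈ worlds
  rel_right : ∀ {a w w'}, rel a w w' → w' ∈ worlds

/-- Truth of a complex formula at a world of a model. -/
def PDLModel.Sat (M : PDLModel Atom Act) : Valuation Atom → Formula Atom Act → Prop
  | w, .atom p => p ∈ w
  | _, .top => True
  | _, .bot => False
  | w, .box a Φ => ∀ w', M.rel a w w' → M.Sat w' Φ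
  | w, .neg Φ => ¬ M.Sat w Φ
  | w, .and Φ Ψ => M.Sat w Φ ∧ M.Sat w Ψ
  | w, .or Φ Ψ => M.Sat w Φ ∨ M.Sat w Ψ
  | w, .imp Φ Ψ => M.Sat w Φ → M.Sat w Ψ
  | w, .iff Φ Ψ => (M.Sat w Φ ↔ M.Sat w Ψ)

/-- `M` is a model of the formula `Φ`: `Φ` is true at every possible world of `M`. -/
def PDLModel.Models (M : PDLModel Atom Act) (Φ : Formula Atom Act) : Prop :=
  ∀ w ∈ M.worlds, M.Sat w Φ

/-- Global consequence: every model of all formulas in `Γ` is a model of `Φ`. -/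
def PDLEntails (Γ : Set (Formula Atom Act)) (Φ : Formula Atom Act) : Prop :=
  ∀ M : PDLModel Atom Act, (∀ Ψ ∈ Γ, M.Models Ψ) → M.Models Φ

end Semantics

section Theories

/-- The three types of laws: static laws `φ`, effect laws `φ → [a]ψ`, and executability laws
`φ → ⟨a⟩⊤`, with `φ`, `ψ` Boolean. -/
inductive Law (Atom Act : Type*) where
  | static (φ : BoolFormula Atom)
  | effect (φ : BoolFormula Atom) (a : Act) (ψ : BoolFormula Atom)
  | exec (φ : BoolFormula Atom) (a : Act)

variable {Atom Act : Type*}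

/-- The formula expressing a law. -/
def Law.toFormula : Law Atom Act → Formula Atom Act
  | .static φ => φ.toFormula
  | .effect φ a ψ => .imp φ.toFormula (.box a ψ.toFormula)
  | .exec φ a => .imp φ.toFormula (.dia a .top)

/-- An action theory is a set of static, effect and executability laws. -/
abbrev ActionTheory (Atom Act : Type*) := Set (Law Atom Act)

/-- The formulas expressing the laws of a theory. -/
def ActionTheory.formulas (T : ActionTheory Atom Act) : Set (Formula Atom Act) :=
  Law.toFormula '' T

/-- `S`: the Boolean formulas that are static laws of `T`. -/
def ActionTheory.stat (T : ActionTheory Atom Act) : Set (BoolFormula Atom) :=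
  {φ | Law.static φ ∈ T}

/-- The laws of `T` that are effect laws for the action `a`. -/
def ActionTheory.eff (T : ActionTheory Atom Act) (a : Act) : ActionTheory Atom Act :=
  {l | l ∈ T ∧ ∃ φ ψ, l = Law.effect φ a ψ}

/-- The laws of `T` that are executability laws for the action `a`. -/
def ActionTheory.exe (T : ActionTheory Atom Act) (a : Act) : ActionTheory Atom Act :=
  {l | l ∈ T ∧ ∃ φ, l = Law.exec φ a}

/-- `T` entails the formula of the law `l`. -/
def ActionTheory.Entails (T : ActionTheory Atom Act) (l : Law Atom Act) : Prop :=
  PDLEntails T.formulas l.toFormula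

/-- Modularity: every Boolean consequence of `T` follows classically from its static laws. -/
def ActionTheory.Modular (T : ActionTheory Atom Act) : Prop :=
  ∀ φ : BoolFormula Atom, PDLEntails T.formulas φ.toFormula → CPLEntails T.stat φ

end Theories

section PrimeImplicants

variable {Atom : Type*}

/-- The finite set `π` of literals is a term (no literal occurs with its complement) that
implies every formula of `Γ`, i.e. an implicant of the conjunction of `Γ`. -/
def IsImplicant (π : Finset (Literal Atom)) (Γ : Set (BoolFormula Atom)) : Prop :=
  (∀ l ∈ π, l.compl ∉ π) ∧ ∀ γ ∈ Γ, CPLEntails {litConj π} γ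

/-- `π` is a prime implicant of the conjunction of `Γ`: an implicant that is weakest among
the implicants, i.e. equivalent to every implicant that it implies. -/
def IsPrimeImplicant (π : Finset (Literal Atom)) (Γ : Set (BoolFormula Atom)) : Prop :=
  IsImplicant π Γ ∧
    ∀ τ, IsImplicant τ Γ → CPLEntails {litConj π} (litConj τ) → CPLEntails {litConj τ} (litConj π)

variable [Fintype Atom]

open Classical in
/-- The atoms that do not occur in the term `π`. -/
noncomputable def atomsOutside (π : Finset (Literal Atom)) : Finset Atom :=
  Finset.univ.filter fun p => ∀ l ∈ π, l.atom ≠ p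

open Classical in
/-- `φ_A`: the atoms outside `π` that are in `A`, and the negations of those that are not. -/
noncomputable def completion (π : Finset (Literal Atom)) (A : Finset Atom) : BoolFormula Atom :=
  .and
    (BoolFormula.conj (((atomsOutside π).filter (· ∈ A)).toList.map BoolFormula.atom))
    (BoolFormula.conj (((atomsOutside π).filter (· ∉ A)).toList.map fun p => .neg (.atom p)))

/-- The complete context `π ∧ φ_A`. -/
noncomputable def context (π : Finset (Literal Atom)) (A : Finset Atom) : BoolFormula Atom :=
  .and (litConj π) (completion π A)

/-- The contexts in which the contraction of a law with antecedent `φ` is carried out: pairs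
of a prime implicant `π` of `S ∧ φ` and a set `A` of atoms outside `π` such that `π ∧ φ_A` is
consistent with `S`. -/
def IsContext (S : Set (BoolFormula Atom)) (φ : BoolFormula Atom)
    (π : Finset (Literal Atom)) (A : Finset Atom) : Prop :=
  IsPrimeImplicant π (S ∪ {φ}) ∧ A ⊆ atomsOutside π ∧
    ¬ CPLEntails S (.imp (context π A) .bot)

end PrimeImplicants

section Contraction

variable {Atom Act : Type*}

/-- A (possibly nondeterministic) change operator for classical logic: `op S φ` is the set of
the possible results of giving up `φ` in the set `S` of Boolean formulas. -/
abbrev ClassicalChange (Atom : Type*) :=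
  Set (BoolFormula Atom) → BoolFormula Atom → Set (Set (BoolFormula Atom))

/-- `op` is a classical contraction or erasure operator: each of its results satisfies the basic
Katsuno-Mendelzon postulates, in the form common to contraction and erasure. -/
structure IsClassicalContraction (op : ClassicalChange Atom) : Prop where
  /-- monotonicity -/
  inclusion : ∀ S φ, ∀ S' ∈ op S φ, ∀ σ ∈ S', CPLEntails S σ
  /-- preservation -/
  preservation : ∀ S φ, ∀ S' ∈ op S φ, ¬ CPLEntails S .bot → CPLEntails S (.neg φ) →
    ∀ σ ∈ S, CPLEntails S' σ
  /-- success -/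
  success : ∀ S φ, ∀ S' ∈ op S φ, ¬ CPLEntails S .bot → ¬ CPLEntails ∅ φ → ¬ CPLEntails S' φ
  /-- equivalence -/
  equivalence : ∀ S₁ S₂ φ₁ φ₂,
    (∀ χ, CPLEntails S₁ χ ↔ CPLEntails S₂ χ) → CPLEntails ∅ (.iff φ₁ φ₂) →
    ∀ S₁' ∈ op S₁ φ₁, ∃ S₂' ∈ op S₂ φ₂, ∀ χ, CPLEntails S₁' χ ↔ CPLEntails S₂' χ
  /-- recovery -/
  recovery : ∀ S φ, ∀ S' ∈ op S φ, ∀ σ ∈ S, CPLEntails (S' ∪ {φ}) σ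

/-- Contraction of the static law `φ` from `T`. The executability laws are restricted to the
context `φ`, and every action becomes inexecutable in the context `¬φ`. -/
def contractStatic (op : ClassicalChange Atom) (T : ActionTheory Atom Act)
    (φ : BoolFormula Atom) : Set (ActionTheory Atom Act) :=
  {T' | (CPLEntails T.stat φ ∧ ∃ S' ∈ op T.stat φ,
          T' = (((T \ (Law.static '' T.stat)) ∪ Law.static '' S') \ ⋃ a, T.exe a)
            ∪ {l | ∃ φi a, Law.exec φi a ∈ T ∧ l = Law.exec (.and φi φ) a}
            ∪ {l | ∃ a, l = Law.effect (.neg φ) a .bot}) ∨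
        (¬ CPLEntails T.stat φ ∧ T' = T)}

/-- The minimal sets of effect laws for `a` in `T` that, together with the static laws, entail
`φ → [a]ψ`. -/
def IsMinimalSupport (T : ActionTheory Atom Act) (φ : BoolFormula Atom) (a : Act)
    (ψ : BoolFormula Atom) (E : ActionTheory Atom Act) : Prop :=
  Minimal (fun F : ActionTheory Atom Act => F ⊆ T.eff a ∧
    ActionTheory.Entails (Law.static '' T.stat ∪ F) (.effect φ a ψ)) E

/-- The union of all minimal supports of `φ → [a]ψ` in `T`. -/
def effMinus (T : ActionTheory Atom Act) (φ : BoolFormula Atom) (a : Act)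
    (ψ : BoolFormula Atom) : ActionTheory Atom Act :=
  ⋃₀ {E | IsMinimalSupport T φ a ψ E}

variable [Fintype Atom]

/-- Contraction of the executability law `φ → ⟨a⟩⊤` from `T`. -/
def contractExec (T : ActionTheory Atom Act) (φ : BoolFormula Atom) (a : Act) :
    Set (ActionTheory Atom Act) :=
  {T' | (T.Entails (.exec φ a) ∧ ∃ π A, IsContext T.stat φ π A ∧
          T' = (T \ T.exe a)
            ∪ {l | ∃ φi, Law.exec φi a ∈ T ∧ l = Law.exec (.and φi (.neg (context π A))) a}) ∨
        (¬ T.Entails (.exec φ a) ∧ T' = T)}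

/-- The literals `l` whose preservation is stated when a transition from the context `π ∧ φ_A`
to a `π'`-world is admitted: `l` is in some set `L` of literals that follow from `π ∧ φ_A` and
are jointly consistent with `π'`, and `l` is in `π'` or `T` does not force `l` to change. -/
def IsPreserved (T : ActionTheory Atom Act) (a : Act) (π : Finset (Literal Atom))
    (A : Finset Atom) (π' : Finset (Literal Atom)) (l : Literal Atom) : Prop :=
  ∃ L : Finset (Literal Atom),
    CPLEntails T.stat (.imp (context π A) (litConj L)) ∧
    ¬ CPLEntails T.stat (.imp (.and (litConj π') (litConj L)) .bot) ∧
    l ∈ L ∧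
    (¬ T.Entails (.effect (.and (context π A) l.toBool) a l.compl.toBool) ∨ l ∈ π')

/-- Contraction of the effect law `φ → [a]ψ` from `T`. -/
def contractEffect (T : ActionTheory Atom Act) (φ : BoolFormula Atom) (a : Act)
    (ψ : BoolFormula Atom) : Set (ActionTheory Atom Act) :=
  {T' | (T.Entails (.effect φ a ψ) ∧ ∃ π A π', IsContext T.stat φ π A ∧
          IsPrimeImplicant π' (T.stat ∪ {.neg ψ}) ∧
          T' = (T \ effMinus T φ a ψ)
            ∪ {l | ∃ φi ψi, Law.effect φi a ψi ∈ effMinus T φ a ψ ∧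
                l = Law.effect (.and φi (.neg (context π A))) a ψi}
            ∪ {l | ∃ φi ψi, Law.effect φi a ψi ∈ effMinus T φ a ψ ∧
                l = Law.effect (.and φi (context π A)) a (.or ψi (litConj π'))}
            ∪ {l | ∃ x : Literal Atom, IsPreserved T a π A π' x ∧
                l = Law.effect (.and (context π A) x.toBool) a (.or ψ x.toBool)}) ∨
        (¬ T.Entails (.effect φ a ψ) ∧ T' = T)}

/-- The set of the possible results of contracting a law from `T`. -/
def contract (op : ClassicalChange Atom) (T : ActionTheory Atom Act) :
    Law Atom Act → Set (ActionTheory Atom Act)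
  | .static φ => contractStatic op T φ
  | .effect φ a ψ => contractEffect T φ a ψ
  | .exec φ a => contractExec T φ a

end Contraction

end ActionLogic

namespace ActionLogic

variable {Atom Act : Type*}

/-! Recovery is checked law by law and world by world in a fixed model of `T'` and `Φ`. A law that
the contraction leaves alone is in `T'`, and the laws it adds can only strengthen `T'`; so only the
weakened laws matter.

For effect and executability laws the weakening is confined to a context `c`. At a world outside
`c`, the copy guarded by `¬c` gives back the old law. At a world inside `c`, the antecedent `φ`
holds, because `c` contains an implicant of `S ∧ φ`, so `Φ` itself takes over: it either supplies
the successor, or forces `ψ` at every successor and so rules out the extra disjunct `π'`, which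
implies `¬ψ`.

For a static `Φ`, the recovery postulate of the classical operator applies to the valuation of each
world. -/

/-- Truth of a Boolean formula at a world is satisfaction by the underlying valuation. -/
theorem PDLModel.sat_toFormula (M : PDLModel Atom Act) (w : Valuation Atom)
    (φ : BoolFormula Atom) : M.Sat w φ.toFormula ↔ φ.Sat w := by
  induction φ <;> simp_all [BoolFormula.toFormula, PDLModel.Sat, BoolFormula.Sat]

theorem PDLModel.models_static_iff {M : PDLModel Atom Act} {φ : BoolFormula Atom} :
    M.Models (Law.static φ).toFormula ↔ ∀ w ∈ M.worlds, φ.Sat w :=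
  forall₂_congr fun w _ => M.sat_toFormula w φ

theorem PDLModel.models_effect_iff {M : PDLModel Atom Act} {φ ψ : BoolFormula Atom} {a : Act} :
    M.Models (Law.effect φ a ψ).toFormula ↔
      ∀ w ∈ M.worlds, φ.Sat w → ∀ w', M.rel a w w' → ψ.Sat w' := by
  simp only [Models, Law.toFormula, Sat, sat_toFormula]

theorem PDLModel.models_exec_iff {M : PDLModel Atom Act} {φ : BoolFormula Atom} {a : Act} :
    M.Models (Law.exec φ a).toFormula ↔
      ∀ w ∈ M.worlds, φ.Sat w → ∃ w', M.rel a w w' := by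
  simp only [Models, Law.toFormula, Formula.dia, Sat, sat_toFormula]
  -- What is left is `¬[a]¬⊤` spelled out over successors, which amounts to the existence of one.
  simp

/-- Every implicant of `Γ` implies each formula of `Γ`. -/
theorem IsImplicant.sat {π : Finset (Literal Atom)} {Γ : Set (BoolFormula Atom)}
    (h : IsImplicant π Γ) {γ : BoolFormula Atom} (hγ : γ ∈ Γ) {v : Valuation Atom}
    (hv : (litConj π).Sat v) : γ.Sat v :=
  h.2 γ hγ v (by simpa using hv)

/-- A context of `φ` implies `φ`. -/
theorem IsContext.sat [Fintype Atom] {S : Set (BoolFormula Atom)} {φ : BoolFormula Atom}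
    {π : Finset (Literal Atom)} {A : Finset Atom} (h : IsContext S φ π A) {v : Valuation Atom}
    (hv : (context π A).Sat v) : φ.Sat v :=
  h.1.1.sat (Or.inr rfl) hv.1

/-- Since `φ` holds at every world, the guard `φ` added to the executability laws costs nothing, and
the static laws return by classical recovery. -/
theorem contractStatic_recovery {op : ClassicalChange Atom} (hop : IsClassicalContraction op)
    {T T' : ActionTheory Atom Act} {φ : BoolFormula Atom} (hT' : T' ∈ contractStatic op T φ)
    {M : PDLModel Atom Act} (hM : ∀ l ∈ T', M.Models l.toFormula)
    (hφ : M.Models (Law.static φ).toFormula) {l : Law Atom Act} (hl : l ∈ T) :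
    M.Models l.toFormula := by
  rcases hT' with ⟨-, S', hS', rfl⟩ | ⟨-, rfl⟩
  · rw [PDLModel.models_static_iff] at hφ
    cases l with
    | static σ =>
      -- A world is itself a valuation, so the classical consequence `S' ∪ {φ} ⊢ σ` can be evaluated
      -- at `w`.
      refine PDLModel.models_static_iff.2 fun w hw => hop.recovery _ _ S' hS' σ hl w ?_
      rintro τ (hτ | rfl)
      · exact PDLModel.models_static_iff.1
          (hM (.static τ) (.inl (.inl ⟨.inr ⟨τ, hτ, rfl⟩, by simp [ActionTheory.exe]⟩))) w hw
      · exact hφ w hw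
    | effect χ a ψ =>
      -- Only static and executability laws are taken out of `T`, so effect laws survive both set
      -- differences.
      exact hM _ (.inl (.inl ⟨.inl ⟨hl, by simp⟩, by simp [ActionTheory.exe]⟩))
    | exec χ a =>
      have h := PDLModel.models_exec_iff.1 (hM (.exec (.and χ φ) a) (.inl (.inr ⟨χ, a, hl, rfl⟩)))
      exact PDLModel.models_exec_iff.2 fun w hw hχ => h w hw ⟨hχ, hφ w hw⟩
  · exact hM l hl

/-- Guarantees that each weakened law has the shape `χ → [a]θ`, so that its two guarded replacements
can be named. -/
theorem effMinus_subset (T : ActionTheory Atom Act) (φ : BoolFormula Atom) (a : Act)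
    (ψ : BoolFormula Atom) : effMinus T φ a ψ ⊆ T.eff a :=
  Set.sUnion_subset fun _ hF => hF.1.1

variable [Fintype Atom]

theorem contractExec_recovery {T T' : ActionTheory Atom Act} {φ : BoolFormula Atom} {a : Act}
    (hT' : T' ∈ contractExec T φ a) {M : PDLModel Atom Act}
    (hM : ∀ l ∈ T', M.Models l.toFormula) (hφ : M.Models (Law.exec φ a).toFormula)
    {l : Law Atom Act} (hl : l ∈ T) : M.Models l.toFormula := by
  rcases hT' with ⟨-, π, A, hc, rfl⟩ | ⟨-, rfl⟩
  · by_cases hla : l ∈ T.exe a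
    · obtain ⟨-, χ, rfl⟩ := hla
      have h := PDLModel.models_exec_iff.1
        (hM (.exec (.and χ (.neg (context π A))) a) (.inr ⟨χ, hl, rfl⟩))
      refine PDLModel.models_exec_iff.2 fun w hw hχ => ?_
      by_cases hw' : (context π A).Sat w
      -- Inside the context the successor comes from `Φ`, not from the law being recovered.
      · exact PDLModel.models_exec_iff.1 hφ w hw (hc.sat hw')
      · exact h w hw ⟨hχ, hw'⟩
    · exact hM l (.inl ⟨hl, hla⟩)
  · exact hM l hl

theorem contractEffect_recovery {T T' : ActionTheory Atom Act} {φ ψ : BoolFormula Atom} {a : Act}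
    (hT' : T' ∈ contractEffect T φ a ψ) {M : PDLModel Atom Act}
    (hM : ∀ l ∈ T', M.Models l.toFormula) (hφ : M.Models (Law.effect φ a ψ).toFormula)
    {l : Law Atom Act} (hl : l ∈ T) : M.Models l.toFormula := by
  rcases hT' with ⟨-, π, A, π', hc, hπ', rfl⟩ | ⟨-, rfl⟩
  · by_cases hla : l ∈ effMinus T φ a ψ
    · obtain ⟨-, χ, θ, rfl⟩ := effMinus_subset T φ a ψ hla
      have hout := PDLModel.models_effect_iff.1
        (hM (.effect (.and χ (.neg (context π A))) a θ) (.inl (.inl (.inr ⟨χ, θ, hla, rfl⟩))))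
      have hin := PDLModel.models_effect_iff.1
        (hM (.effect (.and χ (context π A)) a (.or θ (litConj π')))
          (.inl (.inr ⟨χ, θ, hla, rfl⟩)))
      refine PDLModel.models_effect_iff.2 fun w hw hχ w' hww' => ?_
      by_cases hcw : (context π A).Sat w
      -- The successor satisfies `θ ∨ π'`. The second case is impossible: `π'` is an implicant of
      -- `¬ψ`, while `Φ` forces `ψ` there because the context implies `φ`.
      · refine (hin w hw ⟨hχ, hcw⟩ w' hww').resolve_right fun hw' => ?_
        exact hπ'.1.sat (Or.inr rfl) hw'
          (PDLModel.models_effect_iff.1 hφ w hw (hc.sat hcw) w' hww')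
      · exact hout w hw ⟨hχ, hcw⟩ w' hww'
    · exact hM l (.inl (.inl (.inl ⟨hl, hla⟩)))
  · exact hM l hl

end ActionLogic

theorem mainTheorem6 {Atom Act : Type*} [Fintype Atom]
    (op : ActionLogic.ClassicalChange Atom) (hop : ActionLogic.IsClassicalContraction op)
    (T : ActionLogic.ActionTheory Atom Act) (hT : T.Modular)
    (Φ : ActionLogic.Law Atom Act)
    (T' : ActionLogic.ActionTheory Atom Act) (hT' : T' ∈ ActionLogic.contract op T Φ) :
    ∀ Ψ ∈ T.formulas, ActionLogic.PDLEntails (T'.formulas ∪ {Φ.toFormula}) Ψ := by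
  rintro _ ⟨l, hl, rfl⟩ M hM
  have hMT' : ∀ l' ∈ T', M.Models l'.toFormula := fun l' hl' => hM _ (.inl ⟨l', hl', rfl⟩)
  have hMΦ : M.Models Φ.toFormula := hM _ (.inr rfl)
  cases Φ with
  | static φ => exact ActionLogic.contractStatic_recovery hop hT' hMT' hMΦ hl
  | effect φ a ψ => exact ActionLogic.contractEffect_recovery hT' hMT' hMΦ hl
  | exec φ a => exact ActionLogic.contractExec_recovery hT' hMT' hMΦ hl
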